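/- For a positive integer $n$ and $f\colon\{0,1\}^n\to\{0,1\}$, a rational representation of $f$ is a pair $(p,q)$ of multilinear polynomials $p,q\in\mathbb{R}[X_1,\dots,X_n]$ (that is, of degree at most one in each variable) such that $q(x)\neq 0$ and $p(x)/q(x)=f(x)$ for all $x\in\{0,1\}^n$. The rational degree $\operatorname{rdeg}(f)$ is the minimum of $\max(\deg p,\deg q)$ over all rational representations of $f$. We say that $f$ depends on all $n$ variables if for every $i\in\{1,\dots,n\}$ there is an $x\in\{0,1\}^n$ such that flipping the $i$-th bit of $x$ changes the value of $f$. Theorem. There is an absolute constant $c>0$ such that, for every positive integer $n$ and every $f\colon\{0,1\}^n\to\{0,1\}$ that depends on all $n$ variables, $\operatorname{rdeg}(f)\geq c\log n$. In short, $\operatorname{rdeg}(f)\geq\Omega(\log n)$. -/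

import Mathlib

/-- The real `0/1`-vector of a Boolean input `x ∈ {0,1}^n`. -/
def bitVec {n : ℕ} (x : Fin n → Bool) : Fin n → ℝ :=
  fun i => if x i then 1 else 0

/-- A polynomial is multilinear if every variable has degree at most one in it. -/
def IsMultilinear {n : ℕ} (p : MvPolynomial (Fin n) ℝ) : Prop :=
  ∀ i : Fin n, p.degreeOf i ≤ 1

/-- `p / q` is a rational representation of `f : {0,1}^n → {0,1}`: the polynomials `p` and `q` are
multilinear, `q` vanishes nowhere on `{0,1}^n`, and `p(x) / q(x) = f(x)` on `{0,1}^n`. -/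
def IsRationalRep {n : ℕ} (f : (Fin n → Bool) → Bool) (p q : MvPolynomial (Fin n) ℝ) : Prop :=
  IsMultilinear p ∧ IsMultilinear q ∧
    ∀ x : Fin n → Bool, MvPolynomial.eval (bitVec x) q ≠ 0 ∧
      MvPolynomial.eval (bitVec x) p / MvPolynomial.eval (bitVec x) q = if f x then 1 else 0

/-- The numbers `max (deg p) (deg q)` over all rational representations `p / q` of `f`. -/
def rationalRepDegrees {n : ℕ} (f : (Fin n → Bool) → Bool) : Set ℕ :=
  {d | ∃ p q : MvPolynomial (Fin n) ℝ,
    IsRationalRep f p q ∧ max p.totalDegree q.totalDegree = d}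

/-- The rational degree of `f`: the minimum of `max (deg p) (deg q)` over all rational
representations `p / q` of `f` (one exists, see `rationalRepDegrees_nonempty`). -/
noncomputable def rdeg {n : ℕ} (f : (Fin n → Bool) → Bool) : ℕ :=
  sInf (rationalRepDegrees f)

/-- `f` depends on all its variables: for every coordinate `i` there is an input at which flipping
the bit `i` changes the value of `f`. -/
def DependsOnAllVariables {n : ℕ} (f : (Fin n → Bool) → Bool) : Prop :=
  ∀ i : Fin n, ∃ x : Fin n → Bool, f (Function.update x i (!x i)) ≠ f x

/-- Every Boolean function has a rational representation (with denominator `1`), so the infimum in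
`rdeg` is an attained minimum. -/
theorem rationalRepDegrees_nonempty {n : ℕ} (f : (Fin n → Bool) → Bool) :
    (rationalRepDegrees f).Nonempty := by
  classical
  let L : Bool → Fin n → MvPolynomial (Fin n) ℝ := fun b i =>
    if b then MvPolynomial.X i else 1 - MvPolynomial.X i
  have hL : ∀ b i j, (L b i).degreeOf j ≤ if i = j then 1 else 0 := by
    intro b i j
    have hX : (MvPolynomial.X i : MvPolynomial (Fin n) ℝ).degreeOf j ≤ if i = j then 1 else 0 := by
      rw [MvPolynomial.degreeOf_X]; simp only [eq_comm (a := i)]; exact le_rfl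
    cases b
    · refine (MvPolynomial.degreeOf_sub_le _ _ _).trans (max_le ?_ hX)
      have h1 : (1 : MvPolynomial (Fin n) ℝ).degreeOf j = 0 := MvPolynomial.degreeOf_one j
      simp [h1]
    · exact hX
  have hev : ∀ (y x : Fin n → Bool), MvPolynomial.eval (bitVec x) (∏ i, L (y i) i)
      = if x = y then 1 else 0 := by
    intro y x
    rw [map_prod]
    split_ifs with h
    · subst h
      refine Finset.prod_eq_one fun i _ => ?_
      cases hx : x i <;> simp [L, bitVec, hx]
    · obtain ⟨i, hi⟩ := Function.ne_iff.mp h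
      refine Finset.prod_eq_zero (Finset.mem_univ i) ?_
      cases hx : x i <;> cases hy : y i <;> simp_all [L, bitVec]
  let p : MvPolynomial (Fin n) ℝ :=
    ∑ y : Fin n → Bool, MvPolynomial.C (if f y then 1 else 0) * ∏ i, L (y i) i
  refine ⟨_, p, 1, ⟨?_, ?_, ?_⟩, rfl⟩
  · intro j
    refine (MvPolynomial.degreeOf_sum_le _ _ _).trans (Finset.sup_le fun y _ => ?_)
    refine (MvPolynomial.degreeOf_C_mul_le _ _ _).trans
      ((MvPolynomial.degreeOf_prod_le _ _ _).trans ?_)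
    exact (Finset.sum_le_sum fun i _ => hL (y i) i j).trans (by simp)
  · intro j
    simp [MvPolynomial.degreeOf_one]
  · intro x
    have hp : MvPolynomial.eval (bitVec x) p = if f x then 1 else 0 := by
      simp only [p, map_sum, map_mul, MvPolynomial.eval_C, hev]
      simp
    simp [hp]

/-!
Let `p / q` represent `f` with degree `d` and put `r = q - p`. On the cube `p` is nonzero exactly
where `f = 1`, and `r` exactly where `f = 0`.

Every influence is at least `4 ^ (-d)`: if `f` depends on the `i`-th bit, the function
`p x * r (x^i)` of degree at most `2 d` is not identically zero, and it is supported on inputs where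
that bit is pivotal, while a nonzero polynomial of degree `m` is nonzero on at least a fraction
`2 ^ (-m)` of the cube.

The total influence is at most `2 d ^ 4`. At a point `a` where `|p|` is maximal, take a maximal
family of disjoint blocks of at most `d` bits such that flipping any one of them at `a` makes `r`
nonzero, hence `p` zero. Markov's inequality bounds the number of these blocks by `2 d ^ 2`. By
maximality `r` vanishes as soon as the bits in the union `K` of the blocks agree with `a`, so fixing
the bits of `K` arbitrarily lowers the degree of `r`. Repeating this at most `d` times makes `f`
constant, and each round contributes at most `|K| ≤ 2 d ^ 3` to the total influence.

If `f` depends on all `n` bits, the two bounds give `n ≤ 4 ^ d * 2 d ^ 4`.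
-/

namespace BooleanCube

open Finset

section Flip

variable {ι : Type*} [DecidableEq ι]

/-- The input `x^S` obtained from `x` by flipping the bits in `S`. -/
def flipSet (S : Finset ι) (x : ι → Bool) : ι → Bool :=
  fun i => x i ^^ decide (i ∈ S)

lemma flipSet_empty (x : ι → Bool) : flipSet ∅ x = x := by
  funext i
  simp [flipSet]

lemma flipSet_singleton (i : ι) (x : ι → Bool) :
    flipSet {i} x = Function.update x i (!x i) := by
  funext j
  obtain rfl | hj := eq_or_ne j i <;> simp [flipSet, *]

lemma flipSet_insert {i : ι} {S : Finset ι} (hi : i ∉ S) (x : ι → Bool) :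
    flipSet (insert i S) x = flipSet {i} (flipSet S x) := by
  funext j
  obtain rfl | hj := eq_or_ne j i <;> simp [flipSet, *]

lemma flipSet_involutive (S : Finset ι) : Function.Involutive (flipSet S) := by
  intro x
  funext i
  simp [flipSet]

lemma piecewise_eq_flipSet [Fintype ι] (K : Finset ι) (a x : ι → Bool) :
    K.piecewise a x = flipSet {i | i ∉ K ∧ a i ≠ x i} a := by
  funext i
  by_cases hi : i ∈ K
  · simp [flipSet, hi]
  · cases ha : a i <;> cases hx : x i <;> simp [flipSet, hi, ha, hx]

lemma piecewise_flipSet_singleton {K : Finset ι} {i : ι} (hi : i ∉ K) (a x : ι → Bool) :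
    K.piecewise a (flipSet {i} x) = flipSet {i} (K.piecewise a x) := by
  funext j
  by_cases hj : j ∈ K
  · simp [flipSet, hj, ne_of_mem_of_not_mem hj hi]
  · simp [flipSet, hj]

lemma apply_eq_of_flip_invariant [Finite ι] {α : Type*} {F : (ι → Bool) → α}
    (hF : ∀ i x, F (flipSet {i} x) = F x) (x y : ι → Bool) : F x = F y := by
  have := Fintype.ofFinite ι
  have flip_eq : ∀ S, F (flipSet S y) = F y := fun S => by
    induction S using Finset.induction_on with
    | empty => rw [flipSet_empty]
    | insert i S hi ih => rw [flipSet_insert hi, hF, ih]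
  rw [← piecewise_empty y x, piecewise_eq_flipSet, flip_eq]

end Flip

section Degree

variable {R : Type*} [CommRing R] {ι κ : Type*} {d e : ℕ}

/-- The coordinate function `x ↦ x_i` on the Boolean cube, with values `0` and `1` in `R`. -/
def coord (R : Type*) [CommRing R] {ι : Type*} (i : ι) (x : ι → Bool) : R :=
  if x i then 1 else 0

/-- The multilinear monomial `∏_{i ∈ S} x_i` as a function on the Boolean cube. -/
def monomialFun (R : Type*) [CommRing R] {ι : Type*} (S : Finset ι) : (ι → Bool) → R :=
  ∏ i ∈ S, coord R i

/-- The functions on the Boolean cube that are given by a polynomial of degree at most `d`.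
Multilinear monomials suffice as generators because `x_i ^ 2 = x_i` on the cube. -/
def degLE (R : Type*) [CommRing R] (ι : Type*) (d : ℕ) : Submodule R ((ι → Bool) → R) :=
  Submodule.span R (monomialFun R '' {S | #S ≤ d})

lemma monomialFun_apply (S : Finset ι) (x : ι → Bool) :
    monomialFun R S x = if ∀ i ∈ S, x i = true then 1 else 0 := by
  simp only [monomialFun, Finset.prod_apply, coord, prod_boole]

lemma monomialFun_mul [DecidableEq ι] (S T : Finset ι) :
    monomialFun R S * monomialFun R T = monomialFun R (S ∪ T) := by
  funext x
  simp only [Pi.mul_apply, monomialFun_apply, ite_zero_mul_ite_zero, mul_one, forall_mem_union]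

lemma monomialFun_mem_degLE {S : Finset ι} (hS : #S ≤ d) : monomialFun R S ∈ degLE R ι d :=
  Submodule.subset_span ⟨S, hS, rfl⟩

lemma degLE_mono (h : d ≤ e) : degLE R ι d ≤ degLE R ι e :=
  Submodule.span_mono (Set.image_mono fun _ hS => le_trans hS h)

lemma const_mem_degLE (c : R) (d : ℕ) : (fun _ => c) ∈ degLE R ι d := by
  convert (degLE R ι d).smul_mem c (monomialFun_mem_degLE (S := ∅) (by simp)) using 1
  funext x
  simp [monomialFun]

lemma apply_mem_degLE (g : Bool → R) (i : ι) : (fun x => g (x i)) ∈ degLE R ι 1 := by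
  have affine : (fun x : ι → Bool => g (x i)) =
      (fun _ => g false) + (g true - g false) • monomialFun R {i} := by
    funext x
    cases h : x i <;> simp [monomialFun, coord, h]
  rw [affine]
  exact add_mem (const_mem_degLE _ _) (Submodule.smul_mem _ _ (monomialFun_mem_degLE (by simp)))

lemma apply_eq_of_mem_degLE_zero {F : (ι → Bool) → R} (hF : F ∈ degLE R ι 0) (x y : ι → Bool) :
    F x = F y := by
  have h : degLE R ι 0 = Submodule.span R {1} := by simp [degLE, monomialFun]
  rw [h] at hF
  obtain ⟨c, rfl⟩ := Submodule.mem_span_singleton.1 hF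
  rfl

lemma mul_mem_degLE {F G : (ι → Bool) → R} (hF : F ∈ degLE R ι d) (hG : G ∈ degLE R ι e) :
    F * G ∈ degLE R ι (d + e) := by
  classical
  suffices degLE R ι d * degLE R ι e ≤ degLE R ι (d + e) from this (Submodule.mul_mem_mul hF hG)
  rw [degLE, degLE, Submodule.span_mul_span, Submodule.span_le]
  rintro _ ⟨_, ⟨S, hS, rfl⟩, _, ⟨T, hT, rfl⟩, rfl⟩
  simp only [monomialFun_mul]
  exact monomialFun_mem_degLE ((card_union_le S T).trans (add_le_add hS hT))

lemma prod_mem_degLE {α : Type*} (S : Finset α) {F : α → (ι → Bool) → R}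
    (hF : ∀ i ∈ S, F i ∈ degLE R ι 1) : ∏ i ∈ S, F i ∈ degLE R ι #S := by
  classical
  induction S using Finset.induction_on with
  | empty => exact const_mem_degLE 1 0
  | insert i S hi ih =>
    rw [prod_insert hi, card_insert_of_notMem hi, add_comm]
    exact mul_mem_degLE (hF i (mem_insert_self i S)) (ih fun j hj => hF j (mem_insert_of_mem hj))

lemma comp_mem_degLE {F : (ι → Bool) → R} (hF : F ∈ degLE R ι d) {σ : (κ → Bool) → ι → Bool}
    (hσ : ∀ i, (fun y => coord R i (σ y)) ∈ degLE R κ 1) :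
    (fun y => F (σ y)) ∈ degLE R κ d := by
  suffices degLE R ι d ≤ (degLE R κ d).comap (LinearMap.funLeft R R σ) from this hF
  rw [degLE, Submodule.span_le]
  rintro _ ⟨S, hS, rfl⟩
  have comp_eq : LinearMap.funLeft R R σ (monomialFun R S) = ∏ i ∈ S, fun y => coord R i (σ y) := by
    funext y
    simp [monomialFun, LinearMap.funLeft_apply]
  rw [SetLike.mem_coe, Submodule.mem_comap, comp_eq]
  exact degLE_mono hS (prod_mem_degLE S fun i _ => hσ i)

lemma comp_piecewise_mem_degLE [DecidableEq ι] {F : (ι → Bool) → R} (hF : F ∈ degLE R ι d)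
    (K : Finset ι) (a : ι → Bool) : (fun x => F (K.piecewise a x)) ∈ degLE R ι d := by
  refine comp_mem_degLE hF fun i => ?_
  by_cases hi : i ∈ K
  · simpa [coord, hi] using const_mem_degLE _ _
  · simpa [coord, hi] using apply_mem_degLE (fun b => if b then 1 else 0) i

lemma comp_flipSet_mem_degLE [DecidableEq ι] {F : (ι → Bool) → R} (hF : F ∈ degLE R ι d)
    (S : Finset ι) : (fun x => F (flipSet S x)) ∈ degLE R ι d :=
  comp_mem_degLE hF fun i => apply_mem_degLE (fun b => if b ^^ decide (i ∈ S) then 1 else 0) i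

lemma comp_flipSet_biUnion_mem_degLE [DecidableEq ι] [Fintype κ] {F : (ι → Bool) → R}
    (hF : F ∈ degLE R ι d) {B : κ → Finset ι} (hB : Pairwise (Function.onFun Disjoint B))
    (a : ι → Bool) :
    (fun y : κ → Bool => F (flipSet (({k | y k} : Finset κ).biUnion B) a)) ∈ degLE R κ d := by
  refine comp_mem_degLE hF fun i => ?_
  by_cases hi : ∃ k, i ∈ B k
  · obtain ⟨k, hk⟩ := hi
    have mem_iff : ∀ l, i ∈ B l ↔ l = k := fun l =>
      ⟨fun hl => by_contra fun h => disjoint_left.1 (hB h) hl hk, fun h => h ▸ hk⟩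
    simpa [coord, flipSet, mem_iff] using apply_mem_degLE (fun b => if a i ^^ b then 1 else 0) k
  · rw [not_exists] at hi
    simpa [coord, flipSet, hi] using const_mem_degLE _ _

lemma eval_mem_degLE (P : MvPolynomial ι R) (hP : P.totalDegree ≤ d) :
    (fun x => MvPolynomial.eval (fun i => coord R i x) P) ∈ degLE R ι d := by
  have eval_eq : (fun x => MvPolynomial.eval (fun i => coord R i x) P) =
      ∑ m ∈ P.support, P.coeff m • monomialFun R m.support := by
    funext x
    simp only [MvPolynomial.eval_eq, Finset.sum_apply, Pi.smul_apply, smul_eq_mul, monomialFun,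
      Finset.prod_apply]
    refine sum_congr rfl fun m _ => congrArg _ (prod_congr rfl fun i hi => ?_)
    cases h : x i <;> simp [coord, h, Finsupp.mem_support_iff.1 hi]
  rw [eval_eq]
  refine sum_mem fun m hm => Submodule.smul_mem _ _ (monomialFun_mem_degLE ?_)
  calc #m.support ≤ m.sum fun _ k => k := by
        rw [card_eq_sum_ones]
        exact sum_le_sum fun i hi => Nat.one_le_iff_ne_zero.2 (Finsupp.mem_support_iff.1 hi)
    _ ≤ d := (MvPolynomial.le_totalDegree hm).trans hP

lemma monomialFun_piecewise [DecidableEq ι] (S K : Finset ι) (a x : ι → Bool) :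
    monomialFun R S (K.piecewise a x) = monomialFun R (S ∩ K) a * monomialFun R (S \ K) x := by
  have split : (∀ i ∈ S, K.piecewise a x i = true) ↔
      (∀ i ∈ S ∩ K, a i = true) ∧ ∀ i ∈ S \ K, x i = true := by
    grind [Finset.piecewise]
  simp only [monomialFun_apply, split, ite_zero_mul_ite_zero, mul_one]

lemma piecewise_sub_piecewise_mem_degLE [DecidableEq ι] {F : (ι → Bool) → R}
    (hF : F ∈ degLE R ι (d + 1)) (K : Finset ι) (a b : ι → Bool) :
    (fun x => F (K.piecewise a x) - F (K.piecewise b x)) ∈ degLE R ι d := by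
  suffices degLE R ι (d + 1) ≤ (degLE R ι d).comap
      (LinearMap.funLeft R R (fun x => K.piecewise a x) -
        LinearMap.funLeft R R (fun x => K.piecewise b x)) from this hF
  rw [degLE, Submodule.span_le]
  rintro _ ⟨S, hS, rfl⟩
  have sub_eq : (LinearMap.funLeft R R (fun x => K.piecewise a x) -
      LinearMap.funLeft R R (fun x => K.piecewise b x)) (monomialFun R S) =
        (monomialFun R (S ∩ K) a - monomialFun R (S ∩ K) b) • monomialFun R (S \ K) := by
    funext x
    simp [LinearMap.funLeft_apply, monomialFun_piecewise, sub_mul]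
  rw [SetLike.mem_coe, Submodule.mem_comap, sub_eq]
  obtain hK | hK := (S ∩ K).eq_empty_or_nonempty
  · simp [hK, monomialFun]
  · refine Submodule.smul_mem _ _ (monomialFun_mem_degLE ?_)
    have := card_inter_add_card_sdiff S K
    have := hK.card_pos
    have : #S ≤ d + 1 := hS
    lia

lemma update_sub_update_mem_degLE [DecidableEq ι] {F : (ι → Bool) → R}
    (hF : F ∈ degLE R ι (d + 1)) (i : ι) (b c : Bool) :
    (fun x => F (Function.update x i b) - F (Function.update x i c)) ∈ degLE R ι d := by
  simpa only [piecewise_singleton] using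
    piecewise_sub_piecewise_mem_degLE hF {i} (fun _ => b) (fun _ => c)

theorem apply_flipSet_eq_zero [DecidableEq ι] {F : (ι → Bool) → R} (hF : F ∈ degLE R ι d)
    (a : ι → Bool) (B : Finset ι) (h : ∀ S ⊆ B, #S ≤ d → F (flipSet S a) = 0) :
    F (flipSet B a) = 0 := by
  induction d generalizing F B with
  | zero =>
    rw [apply_eq_of_mem_degLE_zero hF _ (flipSet ∅ a)]
    exact h ∅ (empty_subset B) (by simp)
  | succ d ih =>
    induction B using Finset.induction_on with
    | empty => exact h ∅ subset_rfl (by simp)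
    | insert i B hi ihB =>
      have update_not : ∀ S, i ∉ S →
          Function.update (flipSet S a) i (!a i) = flipSet (insert i S) a := fun S hS => by
        simp [flipSet_insert hS, flipSet_singleton, flipSet, hS]
      have update_self : ∀ S, i ∉ S → Function.update (flipSet S a) i (a i) = flipSet S a :=
        fun S hS => by simp [flipSet, hS]
      have hB : F (flipSet B a) = 0 := ihB fun S hS => h S (hS.trans (subset_insert i B))
      have hdiff := ih (update_sub_update_mem_degLE hF i (!a i) (a i)) B fun S hS hcard => by
        have hiS : i ∉ S := fun hiS => hi (hS hiS)
        rw [update_not S hiS, update_self S hiS,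
          h _ (insert_subset_insert i hS) ((card_insert_le i S).trans (by lia)),
          h S (hS.trans (subset_insert i B)) (by lia), sub_zero]
      rwa [update_not B hi, update_self B hi, hB, sub_zero] at hdiff

lemma update_sub_update_eq_zero_iff [DecidableEq ι] (F : (ι → Bool) → R) (i : ι) (x : ι → Bool) :
    F (Function.update x i true) - F (Function.update x i false) = 0 ↔
      F (flipSet {i} x) = F x := by
  have update_self := Function.update_eq_self i x
  rw [sub_eq_zero, flipSet_singleton]
  cases h : x i <;> rw [h] at update_self <;> simp only [update_self, Bool.not_true, Bool.not_false]
  exact eq_comm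

lemma card_update_sub_update_ne_zero_le [Fintype ι] [DecidableEq ι] [DecidableEq R]
    (F : (ι → Bool) → R) (i : ι) :
    #{x | F (Function.update x i true) - F (Function.update x i false) ≠ 0} ≤
      2 * #{x | F x ≠ 0} := by
  have card_flip : #{x | F (flipSet {i} x) ≠ 0} = #{x | F x ≠ 0} :=
    card_equiv (flipSet_involutive {i}).toPerm (by simp)
  calc _ ≤ #(({x | F x ≠ 0} : Finset _) ∪ ({x | F (flipSet {i} x) ≠ 0} : Finset _)) := by
        refine card_le_card fun x hx => ?_
        simp only [mem_filter, mem_univ, true_and, mem_union, ne_eq,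
          update_sub_update_eq_zero_iff] at hx ⊢
        by_contra! hzero
        exact hx (hzero.2.trans hzero.1.symm)
    _ ≤ _ := (card_union_le _ _).trans (by rw [card_flip, two_mul])

lemma card_ne_zero_of_forall_apply_eq [Fintype ι] [DecidableEq ι] [DecidableEq R]
    {F : (ι → Bool) → R} (hne : F ≠ 0) (hconst : ∀ x y, F x = F y) :
    #{x | F x ≠ 0} = 2 ^ Fintype.card ι := by
  obtain ⟨z, hz⟩ := Function.ne_iff.1 hne
  rw [filter_true_of_mem fun x _ => hconst z x ▸ hz]
  simp

/-- Some discrete derivative of a nonconstant `F` is nonzero; it has smaller degree and at most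
twice as many nonzeros, which drives the induction on the degree. -/
theorem two_pow_card_le_card_ne_zero [Fintype ι] [DecidableEq ι] [DecidableEq R]
    {F : (ι → Bool) → R} (hF : F ∈ degLE R ι d) (hne : F ≠ 0) :
    2 ^ Fintype.card ι ≤ 2 ^ d * #{x | F x ≠ 0} := by
  induction d generalizing F with
  | zero => simp [card_ne_zero_of_forall_apply_eq hne (apply_eq_of_mem_degLE_zero hF)]
  | succ d ih =>
    by_cases hflip : ∀ i x, F (flipSet {i} x) = F x
    · rw [card_ne_zero_of_forall_apply_eq hne (apply_eq_of_flip_invariant hflip)]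
      exact Nat.le_mul_of_pos_left _ (by positivity)
    · push Not at hflip
      obtain ⟨i, z, hz⟩ := hflip
      calc 2 ^ Fintype.card ι
          ≤ 2 ^ d * #{x | F (Function.update x i true) - F (Function.update x i false) ≠ 0} :=
            ih (update_sub_update_mem_degLE hF i true false)
              (Function.ne_iff.2 ⟨z, (update_sub_update_eq_zero_iff F i z).not.2 hz⟩)
        _ ≤ 2 ^ d * (2 * #{x | F x ≠ 0}) :=
            Nat.mul_le_mul_left _ (card_update_sub_update_ne_zero_le F i)
        _ = 2 ^ (d + 1) * #{x | F x ≠ 0} := by ring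

end Degree

section BernoulliMean

open Polynomial

variable {R : Type*} [CommRing R] {κ : Type*} [Fintype κ] [DecidableEq κ] {d : ℕ}

/-- The expectation of `F` at a random input whose bits are independent and equal to `1` with
probability `X`, as a polynomial in `X`. -/
noncomputable def bernoulliMean : ((κ → Bool) → R) →ₗ[R] R[X] :=
  Fintype.linearCombination R fun y => ∏ k, if y k then X else 1 - X

lemma bernoulliMean_apply (F : (κ → Bool) → R) :
    bernoulliMean F = ∑ y, F y • ∏ k, if y k then (X : R[X]) else 1 - X :=
  Fintype.linearCombination_apply _ _ _

lemma eval_bernoulliMean (F : (κ → Bool) → R) (t : R) :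
    (bernoulliMean F).eval t = ∑ y, F y * ∏ k, if y k then t else 1 - t := by
  simp [bernoulliMean_apply, eval_finsetSum, eval_prod, apply_ite (eval t)]

lemma bernoulliMean_monomialFun (S : Finset κ) :
    bernoulliMean (monomialFun R S) = (X : R[X]) ^ #S := by
  have weight_sum : ∀ k, ∑ b : Bool, (if k ∈ S then (if b then (1 : R[X]) else 0) else 1) *
      (if b then X else 1 - X) = if k ∈ S then X else 1 := fun k => by
    by_cases hk : k ∈ S <;> simp [hk]
  calc bernoulliMean (monomialFun R S)
      = ∑ y : κ → Bool, ∏ k, (if k ∈ S then (if y k then (1 : R[X]) else 0) else 1) *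
          (if y k then X else 1 - X) := by
        rw [bernoulliMean_apply]
        refine sum_congr rfl fun y _ => ?_
        rw [prod_mul_distrib, smul_eq_C_mul, prod_ite_mem, univ_inter, monomialFun,
          Finset.prod_apply, map_prod]
        simp only [coord, apply_ite (C : R →+* R[X]), map_one, map_zero]
    _ = ∏ k, if k ∈ S then X else 1 := by
        simp only [← weight_sum]
        exact (Fintype.prod_sum fun k (b : Bool) =>
          (if k ∈ S then (if b then (1 : R[X]) else 0) else 1) * (if b then X else 1 - X)).symm
    _ = X ^ #S := by rw [prod_ite_mem, univ_inter, prod_const]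

lemma sum_prod_bernoulli_eq_one (t : R) :
    ∑ y : κ → Bool, ∏ k, (if y k then t else 1 - t) = 1 := by
  rw [← Fintype.prod_sum fun (_ : κ) (b : Bool) => if b then t else 1 - t]
  simp

lemma natDegree_bernoulliMean_le {F : (κ → Bool) → R} (hF : F ∈ degLE R κ d) :
    (bernoulliMean F).natDegree ≤ d := by
  suffices degLE R κ d ≤ (degreeLE R d).comap bernoulliMean from
    natDegree_le_of_degree_le (mem_degreeLE.1 (this hF))
  rw [degLE, Submodule.span_le]
  rintro _ ⟨S, hS, rfl⟩
  rw [SetLike.mem_coe, Submodule.mem_comap, bernoulliMean_monomialFun, mem_degreeLE]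
  exact (degree_X_pow_le _).trans (Nat.cast_le.2 hS)

lemma eval_zero_derivative_bernoulliMean (F : (κ → Bool) → R) :
    (derivative (bernoulliMean F)).eval 0 =
      ∑ k, (F (flipSet {k} ⊥) - F ⊥) := by
  have eval_weight : ∀ y : κ → Bool,
      (derivative (∏ k, if y k then (X : R[X]) else 1 - X)).eval 0 =
        ∑ k, (if ∀ l ≠ k, y l = false then 1 else 0) * (if y k then 1 else -1) := fun y => by
    simp only [derivative_prod_finset, eval_finsetSum, eval_mul, eval_prod]
    refine sum_congr rfl fun k _ => congrArg₂ _ ?_ (by cases y k <;> simp)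
    have eval_factor : ∀ l, (if y l then (X : R[X]) else 1 - X).eval 0 =
        if y l = false then 1 else 0 := fun l => by cases y l <;> simp
    simp only [eval_factor, prod_boole, mem_erase, mem_univ, and_true]
  simp only [bernoulliMean_apply, derivative_sum, derivative_smul, eval_finsetSum, eval_smul,
    smul_eq_mul, eval_weight, mul_sum]
  rw [sum_comm]
  refine sum_congr rfl fun k _ => ?_
  have flip_ne : flipSet {k} ⊥ ≠ (⊥ : κ → Bool) := fun h => by
    simpa [flipSet] using congrFun h k
  rw [Fintype.sum_eq_add _ _ flip_ne fun y hy => ?_]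
  · simp +contextual [flipSet, sub_eq_add_neg]
  · suffices ¬∀ l ≠ k, y l = false by rw [if_neg this, zero_mul, mul_zero]
    intro hk
    cases h : y k
    · exact hy.2 (funext fun l => by obtain rfl | hl := eq_or_ne l k <;> simp [*])
    · exact hy.1 (funext fun l => by obtain rfl | hl := eq_or_ne l k <;> simp [flipSet, *])

lemma abs_eval_bernoulliMean_le_one {F : (κ → Bool) → ℝ} (hF : ∀ y, |F y| ≤ 1) {t : ℝ}
    (ht : t ∈ Set.Icc 0 1) : |(bernoulliMean F).eval t| ≤ 1 := by
  have weight_nonneg : ∀ y : κ → Bool, 0 ≤ ∏ k, if y k then t else 1 - t := fun y =>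
    prod_nonneg fun k _ => by split_ifs <;> linarith [ht.1, ht.2]
  calc |(bernoulliMean F).eval t|
      ≤ ∑ y, |F y| * ∏ k, if y k then t else 1 - t := by
        rw [eval_bernoulliMean]
        refine (abs_sum_le_sum_abs _ _).trans_eq (sum_congr rfl fun y _ => ?_)
        rw [abs_mul, abs_of_nonneg (weight_nonneg y)]
    _ ≤ ∑ y : κ → Bool, ∏ k, if y k then t else 1 - t :=
        sum_le_sum fun y _ => mul_le_of_le_one_left (weight_nonneg y) (hF y)
    _ = 1 := sum_prod_bernoulli_eq_one t

/-- Markov brothers' inequality at an endpoint, moved from `[-1, 1]` to `[0, 1]`. -/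
lemma neg_eval_zero_derivative_le {P : ℝ[X]} (hdeg : P.natDegree ≤ d)
    (hP : ∀ t ∈ Set.Icc (0 : ℝ) 1, |P.eval t| ≤ 1) : -(derivative P).eval 0 ≤ 2 * d ^ 2 := by
  set Q : ℝ[X] := P.comp (C (1 / 2) - C (1 / 2) * X)
  have hQdeg : Q.degree ≤ d := by
    have affine_deg : (C (1 / 2 : ℝ) - C (1 / 2) * X).natDegree ≤ 1 := by compute_degree
    refine degree_le_of_natDegree_le (natDegree_comp_le.trans ?_)
    simpa using Nat.mul_le_mul hdeg affine_deg
  have hQ : ∀ x ∈ Set.Icc (-1 : ℝ) 1, |Q.eval x| ≤ 1 := fun x hx => by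
    simp only [Q, eval_comp, eval_sub, eval_mul, eval_C, eval_X]
    exact hP _ ⟨by linarith [hx.2], by linarith [hx.1]⟩
  have hQ' : (derivative Q).eval 1 = -(1 / 2) * (derivative P).eval 0 := by
    simp [Q, derivative_comp]
  have markov := Chebyshev.eval_iterate_derivative_le_of_forall_abs_le_one (k := 1)
    le_rfl hQdeg hQ
  rw [Function.iterate_one, hQ', Chebyshev.derivative_T_eval_one, Int.cast_natCast] at markov
  linarith

theorem sum_sub_apply_flip_le {F : (κ → Bool) → ℝ} (hF : F ∈ degLE ℝ κ d) (hb : ∀ y, |F y| ≤ 1) :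
    ∑ k, (F ⊥ - F (flipSet {k} ⊥)) ≤ 2 * d ^ 2 := by
  have := neg_eval_zero_derivative_le (natDegree_bernoulliMean_le hF)
    fun t ht => abs_eval_bernoulliMean_le_one hb ht
  simpa [eval_zero_derivative_bernoulliMean] using this

end BernoulliMean

section Certificate

variable {ι κ : Type*} [DecidableEq ι] {d e : ℕ}

theorem card_le_of_pairwise_disjoint_zeros [Fintype κ] {p : (ι → Bool) → ℝ} (hp : p ∈ degLE ℝ ι d)
    {a : ι → Bool} (hmax : ∀ x, |p x| ≤ |p a|) (ha : p a ≠ 0) {B : κ → Finset ι}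
    (hB : Pairwise (Function.onFun Disjoint B)) (hzero : ∀ k, p (flipSet (B k) a) = 0) :
    Fintype.card κ ≤ 2 * d ^ 2 := by
  classical
  let F : (κ → Bool) → ℝ := fun y => (p a)⁻¹ * p (flipSet (({k | y k} : Finset κ).biUnion B) a)
  have hF : F ∈ degLE ℝ κ d :=
    Submodule.smul_mem _ (p a)⁻¹ (comp_flipSet_biUnion_mem_degLE hp hB a)
  have hF_le : ∀ y, |F y| ≤ 1 := fun y => by
    rw [abs_mul, abs_inv, inv_mul_le_one₀ (abs_pos.2 ha)]
    exact hmax _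
  have hF_origin : F ⊥ = 1 := by simp [F, flipSet_empty, ha]
  have hF_flip : ∀ k, F (flipSet {k} ⊥) = 0 := fun k => by
    have filter_flip : ({l | flipSet {k} ⊥ l} : Finset κ) = {k} := by
      ext l
      simp [flipSet]
    simp [F, filter_flip, hzero]
  have := sum_sub_apply_flip_le hF hF_le
  simp only [hF_origin, hF_flip, sub_zero, sum_const, card_univ, nsmul_eq_mul, mul_one] at this
  exact_mod_cast this

lemma exists_maximal_pairwiseDisjoint [Finite ι] (P : Finset ι → Prop) :
    ∃ A : Finset (Finset ι), (A : Set (Finset ι)).PairwiseDisjoint id ∧ (∀ S ∈ A, P S) ∧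
      ∀ S, P S → Disjoint S (A.biUnion id) → S = ∅ := by
  obtain ⟨A, ⟨hdisj, hP⟩, hmax⟩ := Set.Finite.exists_maximal
    (s := {A : Finset (Finset ι) | (A : Set (Finset ι)).PairwiseDisjoint id ∧ ∀ S ∈ A, P S})
    (Set.toFinite _) ⟨∅, by simp⟩
  refine ⟨A, hdisj, hP, fun S hS hSA => ?_⟩
  have disj_mem : ∀ T ∈ A, Disjoint S T := (disjoint_biUnion_right S A id).1 hSA
  have mem : S ∈ A := hmax ⟨by
    rw [coe_insert]
    exact hdisj.insert fun T hT _ => disj_mem T hT, forall_mem_insert _ _ _ |>.2 ⟨hS, hP⟩⟩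
    (subset_insert S A) (mem_insert_self S A)
  exact disjoint_self_iff_empty S |>.1 (disj_mem S mem)

theorem exists_small_certificate [Finite ι] {p r : (ι → Bool) → ℝ} (hp : p ∈ degLE ℝ ι d)
    (hr : r ∈ degLE ℝ ι e) (hpr : p * r = 0) (hne : p ≠ 0) :
    ∃ (a : ι → Bool) (K : Finset ι), #K ≤ 2 * d ^ 2 * e ∧ ∀ x, r (K.piecewise a x) = 0 := by
  have := Fintype.ofFinite ι
  have p_or_r : ∀ x, p x = 0 ∨ r x = 0 := fun x => mul_eq_zero.1 (congrFun hpr x)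
  obtain ⟨a, hmax⟩ := Finite.exists_max fun x => |p x|
  have hpa : p a ≠ 0 := fun hpa => hne <| funext fun x =>
    abs_eq_zero.1 (le_antisymm ((hmax x).trans_eq (by simp [hpa])) (abs_nonneg _))
  obtain ⟨A, hdisj, hA, hAmax⟩ :=
    exists_maximal_pairwiseDisjoint fun S => #S ≤ e ∧ r (flipSet S a) ≠ 0
  have hcard : #A ≤ 2 * d ^ 2 := by
    rw [← Fintype.card_coe]
    exact card_le_of_pairwise_disjoint_zeros hp hmax hpa
      (B := fun S : A => S.1) (fun S T hST => hdisj S.2 T.2 (Subtype.coe_injective.ne hST))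
      fun S => (p_or_r _).resolve_right (hA S S.2).2
  refine ⟨a, A.biUnion id, (card_biUnion_le_card_mul A id e fun S hS => (hA S hS).1).trans
    (Nat.mul_le_mul_right e hcard), fun x => ?_⟩
  rw [piecewise_eq_flipSet]
  refine apply_flipSet_eq_zero hr a _ fun S hS hSe => by_contra fun hrS => ?_
  have hSA : Disjoint S (A.biUnion id) :=
    disjoint_left.2 fun i hi => (mem_filter.1 (hS hi)).2.1
  obtain rfl := hAmax S ⟨hSe, hrS⟩ hSA
  rw [flipSet_empty] at hrS
  exact hrS ((p_or_r a).resolve_left hpa)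

end Certificate

section Influence

variable {R : Type*} [CommRing R] {ι : Type*} {d e : ℕ}

/-- The inputs at which flipping the bit `i` changes the value of `f`. Their proportion among all
inputs is the influence of the variable `i` on `f`; influences are kept unnormalized here. -/
def pivotal [Fintype ι] [DecidableEq ι] (f : (ι → Bool) → Bool) (i : ι) : Finset (ι → Bool) :=
  {x | f (flipSet {i} x) ≠ f x}

/-- `p` is a nondeterministic polynomial for `f`: it is nonzero exactly at the inputs that `f`
accepts. -/
def IsNondetRep (p : (ι → Bool) → R) (f : (ι → Bool) → Bool) : Prop :=
  ∀ x, p x ≠ 0 ↔ f x = true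

lemma IsNondetRep.mul_eq_zero {p r : (ι → Bool) → R} {f : (ι → Bool) → Bool}
    (hp : IsNondetRep p f) (hr : IsNondetRep r fun x => !f x) : p * r = 0 := by
  funext x
  by_cases hpx : p x = 0
  · simp [hpx]
  · have hrx : r x = 0 := by
      by_contra hrx
      simpa [(hp x).1 hpx] using (hr x).1 hrx
    simp [hrx]

lemma IsNondetRep.apply_eq_of_const {p : (ι → Bool) → R} {f : (ι → Bool) → Bool}
    (hp : IsNondetRep p f) (hconst : ∀ x y, p x = p y) (x y : ι → Bool) : f x = f y := by
  rw [Bool.eq_iff_iff, ← hp x, ← hp y, hconst x y]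

lemma sum_sum_piecewise {α : ι → Type*} {M : Type*} [DecidableEq ι] [Fintype (∀ i, α i)]
    [AddCommMonoid M] (K : Finset ι) (g : (∀ i, α i) → M) :
    ∑ a, ∑ x, g (K.piecewise a x) = Fintype.card (∀ i, α i) • ∑ x, g x := by
  let swap : (∀ i, α i) × (∀ i, α i) → (∀ i, α i) × (∀ i, α i) :=
    fun z => (K.piecewise z.1 z.2, K.piecewise z.2 z.1)
  have swap_involutive : Function.Involutive swap := by
    rintro ⟨a, x⟩
    ext i <;> by_cases hi : i ∈ K <;> simp [swap, hi]
  calc ∑ a, ∑ x, g (K.piecewise a x) = ∑ z, g (swap z).1 := (Fintype.sum_prod_type' _).symm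
    _ = ∑ z : (∀ i, α i) × (∀ i, α i), g z.1 :=
        Equiv.sum_comp swap_involutive.toPerm fun z => g z.1
    _ = _ := by rw [Fintype.sum_prod_type_right]; simp

variable [Fintype ι] [DecidableEq ι]

lemma pivotal_eq_empty {f : (ι → Bool) → Bool} (hf : ∀ x y, f x = f y) (i : ι) :
    pivotal f i = ∅ :=
  filter_false_of_mem fun _ _ => not_not.2 (hf _ _)

lemma sum_card_pivotal_piecewise (f : (ι → Bool) → Bool) {K : Finset ι} {i : ι} (hi : i ∉ K) :
    ∑ a, #(pivotal (fun x => f (K.piecewise a x)) i) = 2 ^ Fintype.card ι * #(pivotal f i) := by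
  simp only [pivotal, card_filter, piecewise_flipSet_singleton hi]
  rw [sum_sum_piecewise K fun x => if f (flipSet {i} x) ≠ f x then 1 else 0]
  simp

/-- The bits outside `K` are estimated by averaging over all assignments to `K`. -/
lemma sum_card_pivotal_le_of_piecewise (f : (ι → Bool) → Bool) (K : Finset ι) {M : ℕ}
    (hM : ∀ a, ∑ i, #(pivotal (fun x => f (K.piecewise a x)) i) ≤ M) :
    ∑ i, #(pivotal f i) ≤ 2 ^ Fintype.card ι * #K + M := by
  have sum_in : ∑ i ∈ K, #(pivotal f i) ≤ 2 ^ Fintype.card ι * #K := by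
    rw [mul_comm]
    refine sum_le_card_nsmul K _ _ fun i _ => ?_
    exact (card_filter_le _ _).trans_eq (by simp)
  have sum_out : ∑ i ∈ Kᶜ, #(pivotal f i) ≤ M := by
    refine Nat.le_of_mul_le_mul_left ?_ (Nat.two_pow_pos (Fintype.card ι))
    calc 2 ^ Fintype.card ι * ∑ i ∈ Kᶜ, #(pivotal f i)
        = ∑ a, ∑ i ∈ Kᶜ, #(pivotal (fun x => f (K.piecewise a x)) i) := by
          rw [mul_sum, sum_comm]
          exact sum_congr rfl fun i hi =>
            (sum_card_pivotal_piecewise f (mem_compl.1 hi)).symm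
      _ ≤ ∑ _a : ι → Bool, M :=
          sum_le_sum fun a _ => (sum_le_sum_of_subset (subset_univ _)).trans (hM a)
      _ = 2 ^ Fintype.card ι * M := by simp
  rw [← sum_add_sum_compl K]
  exact add_le_add sum_in sum_out

/-- Fixing the bits of a certificate in any way lowers the degree of `r`, since all these
restrictions of `r` have the same leading part and one of them vanishes. -/
theorem sum_card_pivotal_le {f : (ι → Bool) → Bool} {p r : (ι → Bool) → ℝ}
    (hp : IsNondetRep p f) (hr : IsNondetRep r fun x => !f x)
    (hpd : p ∈ degLE ℝ ι d) (hre : r ∈ degLE ℝ ι e) :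
    ∑ i, #(pivotal f i) ≤ 2 ^ Fintype.card ι * (2 * d ^ 2 * e ^ 2) := by
  have sum_eq_zero_of_const (f : (ι → Bool) → Bool) (hf : ∀ x y, f x = f y) :
      ∑ i, #(pivotal f i) = 0 := sum_eq_zero fun i _ => by rw [pivotal_eq_empty hf, card_empty]
  induction e generalizing f p r with
  | zero =>
    have hf : ∀ x y, f x = f y := fun x y =>
      Bool.not_inj (hr.apply_eq_of_const (apply_eq_of_mem_degLE_zero hre) x y)
    exact (sum_eq_zero_of_const f hf).trans_le (Nat.zero_le _)
  | succ e ih =>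
    obtain rfl | hne := eq_or_ne p 0
    · have hf : ∀ x y, f x = f y := hp.apply_eq_of_const fun _ _ => rfl
      exact (sum_eq_zero_of_const f hf).trans_le (Nat.zero_le _)
    obtain ⟨a, K, hK, hrK⟩ := exists_small_certificate hpd hre (hp.mul_eq_zero hr) hne
    have restriction_le : ∀ b, ∑ i, #(pivotal (fun x => f (K.piecewise b x)) i) ≤
        2 ^ Fintype.card ι * (2 * d ^ 2 * e ^ 2) := fun b => by
      have hrb : (fun x => r (K.piecewise b x)) ∈ degLE ℝ ι e := by
        simpa only [hrK, sub_zero] using piecewise_sub_piecewise_mem_degLE hre K b a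
      exact ih (fun x => hp _) (fun x => hr _) (comp_piecewise_mem_degLE hpd K b) hrb
    calc ∑ i, #(pivotal f i)
        ≤ 2 ^ Fintype.card ι * #K + 2 ^ Fintype.card ι * (2 * d ^ 2 * e ^ 2) :=
          sum_card_pivotal_le_of_piecewise f K restriction_le
      _ = 2 ^ Fintype.card ι * (#K + 2 * d ^ 2 * e ^ 2) := by ring
      _ ≤ 2 ^ Fintype.card ι * (2 * d ^ 2 * (e + 1) ^ 2) := by gcongr; nlinarith

theorem two_pow_card_le_card_pivotal [NoZeroDivisors R] {f : (ι → Bool) → Bool}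
    {p r : (ι → Bool) → R} (hp : IsNondetRep p f) (hr : IsNondetRep r fun x => !f x)
    (hpd : p ∈ degLE R ι d) (hre : r ∈ degLE R ι e) {i : ι} (hi : (pivotal f i).Nonempty) :
    2 ^ Fintype.card ι ≤ 2 ^ (d + e) * #(pivotal f i) := by
  classical
  let F : (ι → Bool) → R := p * fun x => r (flipSet {i} x)
  have F_ne_zero_iff : ∀ x, F x ≠ 0 ↔ f x = true ∧ f (flipSet {i} x) = false := fun x => by
    simp [F, mul_ne_zero_iff, hp x, hr (flipSet {i} x), -ne_eq]
  have hFne : F ≠ 0 := by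
    obtain ⟨x, hx⟩ := hi
    have hx : f (flipSet {i} x) ≠ f x := (mem_filter.1 hx).2
    cases h : f x
    · refine Function.ne_iff.2 ⟨flipSet {i} x, (F_ne_zero_iff _).2 ⟨?_, ?_⟩⟩
      · simpa [h] using hx
      · rw [flipSet_involutive, h]
    · exact Function.ne_iff.2 ⟨x, (F_ne_zero_iff x).2 ⟨h, by simpa [h] using hx⟩⟩
  refine (two_pow_card_le_card_ne_zero (mul_mem_degLE hpd (comp_flipSet_mem_degLE hre {i}))
    hFne).trans (Nat.mul_le_mul_left _ (card_le_card fun x hx => ?_))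
  obtain ⟨hfx, hfi⟩ := (F_ne_zero_iff x).1 (mem_filter.1 hx).2
  simp [pivotal, hfx, hfi]

theorem card_le_of_isNondetRep {f : (ι → Bool) → Bool} {p r : (ι → Bool) → ℝ}
    (hp : IsNondetRep p f) (hr : IsNondetRep r fun x => !f x)
    (hpd : p ∈ degLE ℝ ι d) (hre : r ∈ degLE ℝ ι e) (hf : ∀ i, (pivotal f i).Nonempty) :
    Fintype.card ι ≤ 2 ^ (d + e) * (2 * d ^ 2 * e ^ 2) := by
  refine Nat.le_of_mul_le_mul_left ?_ (Nat.two_pow_pos (Fintype.card ι))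
  calc 2 ^ Fintype.card ι * Fintype.card ι = ∑ _i : ι, 2 ^ Fintype.card ι := by simp [mul_comm]
    _ ≤ ∑ i, 2 ^ (d + e) * #(pivotal f i) :=
      sum_le_sum fun i _ => two_pow_card_le_card_pivotal hp hr hpd hre (hf i)
    _ = 2 ^ (d + e) * ∑ i, #(pivotal f i) := (mul_sum _ _ _).symm
    _ ≤ 2 ^ (d + e) * (2 ^ Fintype.card ι * (2 * d ^ 2 * e ^ 2)) :=
      Nat.mul_le_mul_left _ (sum_card_pivotal_le hp hr hpd hre)
    _ = _ := by ring

end Influence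

section RationalDegree

variable {n : ℕ} {f : (Fin n → Bool) → Bool}

lemma isNondetRep_num {p q : MvPolynomial (Fin n) ℝ} (h : IsRationalRep f p q) :
    IsNondetRep (fun x => p.eval (bitVec x)) f := fun x => by
  have ⟨hq, hpq⟩ := h.2.2 x
  rw [div_eq_iff hq] at hpq
  cases hfx : f x <;> simp [hpq, hfx, hq]

lemma isNondetRep_den_sub_num {p q : MvPolynomial (Fin n) ℝ} (h : IsRationalRep f p q) :
    IsNondetRep (fun x => (q - p).eval (bitVec x)) fun x => !f x := fun x => by
  have ⟨hq, hpq⟩ := h.2.2 x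
  rw [div_eq_iff hq] at hpq
  cases hfx : f x <;> simp [hpq, hfx, hq]

lemma pivotal_nonempty (hf : DependsOnAllVariables f) (i : Fin n) : (pivotal f i).Nonempty := by
  obtain ⟨x, hx⟩ := hf i
  exact ⟨x, by simpa [pivotal, flipSet_singleton] using hx⟩

lemma two_pow_mul_pow_four_le (d : ℕ) : 2 ^ (d + d) * (2 * d ^ 2 * d ^ 2) ≤ 128 ^ d := by
  obtain rfl | hd := d.eq_zero_or_pos
  · simp
  calc 2 ^ (d + d) * (2 * d ^ 2 * d ^ 2) = 2 ^ (d + d) * (2 ^ 1 * d ^ 4) := by ring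
    _ ≤ 2 ^ (d + d) * (2 ^ d * (2 ^ d) ^ 4) := by
      gcongr
      · exact one_le_two
      · exact hd
      · exact Nat.lt_two_pow_self.le
    _ = (2 ^ 7) ^ d := by rw [← pow_mul, ← pow_mul]; ring

theorem le_pow_rdeg (hf : DependsOnAllVariables f) : n ≤ 128 ^ rdeg f := by
  obtain ⟨p, q, hpq, hdeg⟩ := Nat.sInf_mem (rationalRepDegrees_nonempty f)
  change max p.totalDegree q.totalDegree = rdeg f at hdeg
  have hp : p.totalDegree ≤ rdeg f := (le_max_left _ _).trans_eq hdeg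
  have hqp : (q - p).totalDegree ≤ rdeg f :=
    (MvPolynomial.totalDegree_sub q p).trans_eq ((max_comm _ _).trans hdeg)
  calc n = Fintype.card (Fin n) := (Fintype.card_fin n).symm
    _ ≤ 2 ^ (rdeg f + rdeg f) * (2 * rdeg f ^ 2 * rdeg f ^ 2) :=
      card_le_of_isNondetRep (isNondetRep_num hpq) (isNondetRep_den_sub_num hpq)
        (eval_mem_degLE p hp) (eval_mem_degLE (q - p) hqp) (pivotal_nonempty hf)
    _ ≤ 128 ^ rdeg f := two_pow_mul_pow_four_le (rdeg f)

end RationalDegree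

end BooleanCube

theorem mainTheorem7 :
    ∃ c : ℝ, 0 < c ∧ ∀ n : ℕ, 0 < n → ∀ f : (Fin n → Bool) → Bool,
      DependsOnAllVariables f → c * Real.log (n : ℝ) ≤ (rdeg f : ℝ) := by
  have log_pos : 0 < Real.log 128 := Real.log_pos (by norm_num)
  refine ⟨(Real.log 128)⁻¹, inv_pos.2 log_pos, fun n hn f hf => ?_⟩
  rw [inv_mul_le_iff₀ log_pos, mul_comm, ← Real.log_pow]
  exact Real.log_le_log (Nat.cast_pos.2 hn) (mod_cast BooleanCube.le_pow_rdeg hf)
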